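/- For a finite multigraph $G$ let $M(G)$ be its cycle matroid (ground set $E(G)$, circuits the edge sets of cycles of $G$) and $M^*(G)$ the dual of $M(G)$. A matroid is \emph{graphic} if it is isomorphic to $M(H)$ for some finite loopless multigraph $H$ (parallel edges allowed), and \emph{cographic} if its dual is graphic. Let $M$ be a matroid isomorphic to $M^*(K_{3,5})$ or to $M^*(K_{4,4}\setminus e)$, where $e$ is any edge of $K_{4,4}$. Then for every cocircuit $Y$ of $M$ the matroid $M\setminus Y$ is graphic; equivalently, for every circuit $Y$ of the dual matroid $M^*$ (which is isomorphic to $M(K_{3,5})$ or $M(K_{4,4}\setminus e)$) the contraction $M^*/Y$ is cographic. -/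

import Mathlib

/-! ### Circles (edge sets of cycles) and forests in a multigraph -/

/-- `C` is a circle of the multigraph `G`: the edge set of a cycle
`v 0, e 0, v 1, e 1, …, v n, e n, v 0` with distinct vertices and distinct edges. Indices are taken
cyclically in `Fin (n + 1)`, so `n = 0` is a loop and `n = 1` a pair of parallel edges. -/
def Graph.IsCircle {V E : Type*} (G : Graph V E) (C : Set E) : Prop :=
  ∃ (n : ℕ) (v : Fin (n + 1) → V) (e : Fin (n + 1) → E),
    Function.Injective v ∧ Function.Injective e ∧
      (∀ i, G.IsLink (e i) (v i) (v (i + 1))) ∧ C = Set.range e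

/-- `I` is a set of edges of `G` that contains no circle. -/
def Graph.IsForestSet {V E : Type*} (G : Graph V E) (I : Set E) : Prop :=
  I ⊆ G.edgeSet ∧ ∀ C, C ⊆ I → ¬ G.IsCircle C

/-! ### Forests are the independent sets of a matroid

Proved through the incidence vectors over the two-element field. -/

open Classical in
/-- The incidence vector over the two-element field of an edge: the sum of its two ends. -/
noncomputable def Graph.incVec {V E : Type*} (G : Graph V E) (e : E) : V →₀ ZMod 2 :=
  if h : ∃ x y, G.IsLink e x y then
    Finsupp.single h.choose 1 + Finsupp.single h.choose_spec.choose 1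
  else 0

theorem Graph.IsLink.incVec_eq {V E : Type*} {G : Graph V E} {e : E} {x y : V}
    (h : G.IsLink e x y) : G.incVec e = Finsupp.single x 1 + Finsupp.single y 1 := by
  have hex : ∃ x y, G.IsLink e x y := ⟨x, y, h⟩
  rw [Graph.incVec, dif_pos hex]
  have h' : G.IsLink e hex.choose hex.choose_spec.choose := hex.choose_spec.choose_spec
  generalize hex.choose_spec.choose = b at h' ⊢
  generalize hex.choose = a at h' ⊢
  rcases h'.eq_and_eq_or_eq_and_eq h with ⟨rfl, rfl⟩ | ⟨rfl, rfl⟩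
  · rfl
  · rw [add_comm]

/-- The incidence vectors of a circle are linearly dependent. -/
theorem Graph.IsCircle.not_linearIndepOn {V E : Type*} {G : Graph V E} {C : Set E}
    (hC : G.IsCircle C) : ¬ LinearIndepOn (ZMod 2) G.incVec C := by
  obtain ⟨n, v, e, -, he, hl, rfl⟩ := hC
  intro h
  rw [linearIndepOn_range_iff he, Fintype.linearIndependent_iff] at h
  have hsum : ∑ i, (1 : ZMod 2) • (G.incVec ∘ e) i = 0 := by
    simp only [one_smul, Function.comp_apply, (hl _).incVec_eq, Finset.sum_add_distrib]
    have h2 : ∑ i, Finsupp.single (v (i + 1)) (1 : ZMod 2) = ∑ i, Finsupp.single (v i) 1 :=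
      Equiv.sum_comp (Equiv.addRight (1 : Fin (n + 1)))
        (fun i => Finsupp.single (v i) (1 : ZMod 2))
    rw [h2, ← two_smul (ZMod 2), show (2 : ZMod 2) = 0 from rfl, zero_smul]
  exact one_ne_zero (h (fun _ => 1) hsum 0)

/-- The simple graph of adjacencies realised by the edges in `J`. -/
def Graph.adjOn {V E : Type*} (G : Graph V E) (J : Set E) : SimpleGraph V where
  Adj x y := x ≠ y ∧ ∃ f ∈ J, G.IsLink f x y
  symm := ⟨fun _ _ h => ⟨h.1.symm, h.2.imp fun _ hf => ⟨hf.1, hf.2.symm⟩⟩⟩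
  loopless := ⟨fun _ h => h.1 rfl⟩

/-- An edge whose ends are joined by edges of `J` closes a circle with some of these edges. -/
theorem Graph.exists_isCircle_of_reachable {V E : Type*} {G : Graph V E} {J : Set E} {e : E}
    {u w : V} (he : G.IsLink e u w) (heJ : e ∉ J) (h : (G.adjOn J).Reachable u w) :
    ∃ C, C ⊆ insert e J ∧ G.IsCircle C := by
  obtain ⟨p, hp⟩ := h.exists_isPath
  have hadj : ∀ i, i < p.length → ∃ f ∈ J, G.IsLink f (p.getVert i) (p.getVert (i + 1)) :=
    fun i hi => (p.adj_getVert_succ hi).2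
  have : Nonempty E := ⟨e⟩
  choose! f hfJ hf using hadj
  have hinj := hp.getVert_injOn
  have hv : ∀ a b, a ≤ p.length → b ≤ p.length → p.getVert a = p.getVert b → a = b :=
    fun a b ha hb hab => hinj ha hb hab
  refine ⟨_, ?_, p.length, fun i => p.getVert i,
    fun i => if (i : ℕ) < p.length then f i else e, ?_, ?_, ?_, rfl⟩
  · rintro _ ⟨i, rfl⟩
    by_cases hi : (i : ℕ) < p.length
    · simp only [hi, if_true]
      exact Or.inr (hfJ _ hi)
    · simp [hi]
  · intro i j hij
    exact Fin.ext (hv _ _ (by omega) (by omega) hij)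
  · intro i j hij
    apply Fin.ext
    by_cases hi : (i : ℕ) < p.length <;> by_cases hj : (j : ℕ) < p.length
    · simp only [hi, hj, if_true] at hij
      have h1 := hf _ hi
      rw [hij] at h1
      rcases h1.eq_and_eq_or_eq_and_eq (hf _ hj) with ⟨h2, -⟩ | ⟨h2, h3⟩
      · exact hv _ _ (by omega) (by omega) h2
      · have := hv _ _ (by omega) (by omega) h2
        have := hv _ _ (by omega) (by omega) h3
        omega
    · simp only [hi, hj, if_true, if_false] at hij
      exact absurd (hij ▸ hfJ _ hi) heJ
    · simp only [hi, hj, if_true, if_false] at hij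
      exact absurd (hij ▸ hfJ _ hj) heJ
    · omega
  · intro i
    by_cases hi : (i : ℕ) < p.length
    · have h1 : ((i + 1 : Fin (p.length + 1)) : ℕ) = i + 1 :=
        Fin.val_add_one_of_lt (Fin.lt_def.2 (by simpa using hi))
      simp only [hi, if_true, h1]
      exact hf _ hi
    · have h0 : i = Fin.last _ := Fin.ext (by simp; omega)
      subst h0
      simpa using he.symm

/-- Over the two-element field, forests are the linearly independent sets of edges. -/
theorem Graph.isForestSet_iff_linearIndepOn {V E : Type*} (G : Graph V E) (I : Set E) :
    G.IsForestSet I ↔ I ⊆ G.edgeSet ∧ LinearIndepOn (ZMod 2) G.incVec I := by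
  classical
  refine and_congr_right fun hI => ⟨fun h => ?_, fun h C hCI hC =>
    hC.not_linearIndepOn (h.mono hCI)⟩
  rw [linearIndepOn_iff_notMem_span]
  intro e heI hspan
  obtain ⟨u, w, he⟩ := G.exists_isLink_of_mem_edgeSet (hI heI)
  have hnr : ¬ (G.adjOn (I \ {e})).Reachable u w := fun hr => by
    obtain ⟨C, hC, hC'⟩ := Graph.exists_isCircle_of_reachable he (fun h => h.2 rfl) hr
    refine h C (hC.trans ?_) hC'
    rintro f (rfl | hf)
    exacts [heI, hf.1]
  let φ : (V →₀ ZMod 2) →ₗ[ZMod 2] ZMod 2 := Finsupp.linearCombination (ZMod 2)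
    fun x => if (G.adjOn (I \ {e})).Reachable u x then (1 : ZMod 2) else 0
  have hφ : ∀ f x y, G.IsLink f x y → φ (G.incVec f) =
      (if (G.adjOn (I \ {e})).Reachable u x then 1 else 0) +
        if (G.adjOn (I \ {e})).Reachable u y then 1 else 0 := by
    intro f x y hf
    simp [φ, hf.incVec_eq]
  have hker : Submodule.span (ZMod 2) (G.incVec '' (I \ {e})) ≤ LinearMap.ker φ := by
    rw [Submodule.span_le]
    rintro _ ⟨f, hf, rfl⟩
    obtain ⟨x, y, hxy⟩ := G.exists_isLink_of_mem_edgeSet (hI hf.1)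
    have hr : (G.adjOn (I \ {e})).Reachable x y := by
      by_cases hne : x = y
      · rw [hne]
      · exact SimpleGraph.Adj.reachable ⟨hne, f, hf, hxy⟩
    have hiff : (G.adjOn (I \ {e})).Reachable u x ↔ (G.adjOn (I \ {e})).Reachable u y :=
      ⟨fun h => h.trans hr, fun h => h.trans hr.symm⟩
    rw [SetLike.mem_coe, LinearMap.mem_ker, hφ f x y hxy]
    simp only [hiff]
    exact CharTwo.add_self_eq_zero _
  have h0 := hker hspan
  rw [LinearMap.mem_ker, hφ e u w he] at h0
  simp [hnr] at h0

/-- Forests satisfy the augmentation axiom. -/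
theorem Graph.IsForestSet.augment {V E : Type*} {G : Graph V E} {I J : Set E}
    (hI : G.IsForestSet I) (hIf : I.Finite) (hJ : G.IsForestSet J) (hJf : J.Finite)
    (hlt : I.ncard < J.ncard) : ∃ e ∈ J, e ∉ I ∧ G.IsForestSet (insert e I) := by
  rw [Graph.isForestSet_iff_linearIndepOn] at hI hJ
  by_contra! hcon
  have hmem : ∀ e ∈ J, G.incVec e ∈ Submodule.span (ZMod 2) (G.incVec '' I) := by
    intro e heJ
    by_cases heI : e ∈ I
    · exact Submodule.subset_span ⟨e, heI, rfl⟩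
    · by_contra hns
      refine hcon e heJ heI ((Graph.isForestSet_iff_linearIndepOn G _).2
        ⟨Set.insert_subset (hJ.1 heJ) hI.1, ?_⟩)
      exact (linearIndepOn_insert heI).2 ⟨hI.2, hns⟩
  have : Fintype J := hJf.fintype
  have : Fintype (G.incVec '' I) := (hIf.image _).fintype
  have hle := linearIndependent_le_span_aux' (R := ZMod 2) (fun e : J => G.incVec e) hJ.2
    (G.incVec '' I) (by rintro _ ⟨e, rfl⟩; exact hmem e e.2)
  rw [← Nat.card_eq_fintype_card, ← Nat.card_eq_fintype_card, Nat.card_coe_set_eq,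
    Nat.card_coe_set_eq] at hle
  have := Set.ncard_image_le (f := G.incVec) hIf
  omega

/-! ### Graphic and cographic matroids -/

/-- The cycle matroid `M(G)`: its ground set is the edge set of `G`, and a set of edges is
independent when it contains no circle of `G`. -/
def Graph.cycleMatroid {V E : Type*} (G : Graph V E) : Matroid E :=
  (IndepMatroid.ofFinitaryCardAugment G.edgeSet G.IsForestSet
    ⟨Set.empty_subset _, by
      rintro C hC ⟨n, v, e, -, -, -, rfl⟩
      exact hC ⟨0, rfl⟩⟩
    (fun _ _ hJ hIJ => ⟨hIJ.trans hJ.1, fun C hC => hJ.2 C (hC.trans hIJ)⟩)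
    (fun _ _ hI hIf hJ hJf hlt => hI.augment hIf hJ hJf hlt)
    (fun I h => ⟨fun e he => (h {e} (by simpa using he) (Set.finite_singleton e)).1 rfl,
      fun C hC hcirc => by
        have hfin : C.Finite := by
          obtain ⟨n, v, e, -, -, -, rfl⟩ := hcirc
          exact Set.finite_range e
        exact (h C hC hfin).2 C subset_rfl hcirc⟩)
    (fun _ hI => hI.1)).matroid

@[simp]
theorem Graph.cycleMatroid_E {V E : Type*} (G : Graph V E) :
    G.cycleMatroid.E = G.edgeSet := rfl

@[simp]
theorem Graph.cycleMatroid_indep {V E : Type*} (G : Graph V E) (I : Set E) :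
    G.cycleMatroid.Indep I ↔ G.IsForestSet I := Iff.rfl

open scoped Fin.CommRing in
/-- A circle contained in a circle is the whole circle. -/
theorem Graph.IsCircle.eq_of_subset {V E : Type*} {G : Graph V E} {C D : Set E}
    (hD : G.IsCircle D) (hC : G.IsCircle C) (hDC : D ⊆ C) : D = C := by
  obtain ⟨n, v, e, hv, he, hl, rfl⟩ := hC
  obtain ⟨m, w, f, hw, hf, hk, rfl⟩ := hD
  refine hDC.antisymm ?_
  have step : ∀ i, e i ∈ Set.range f → e (i + 1) ∈ Set.range f := by
    rintro i ⟨j, hj⟩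
    have hi := hl i
    rw [← hj] at hi
    have key : ∃ k, k ≠ j ∧ G.Inc (f k) (v (i + 1)) ∨ n = 0 := by
      by_cases hn : n = 0
      · exact ⟨j, Or.inr hn⟩
      have hm : m ≠ 0 := by
        rintro rfl
        have h1 := hk j
        rw [show j + 1 = j from (Fin.subsingleton_one).elim _ _] at h1
        have h2 : v i = v (i + 1) := by
          rcases h1.eq_and_eq_or_eq_and_eq hi with ⟨a, b⟩ | ⟨a, b⟩
          · exact a.symm.trans b
          · exact b.symm.trans a
        have h3 := hv h2
        have : NeZero n := ⟨hn⟩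
        simp at h3
      have : NeZero m := ⟨hm⟩
      rcases (hk j).eq_and_eq_or_eq_and_eq hi with ⟨a, b⟩ | ⟨a, b⟩
      · exact ⟨j + 1, Or.inl ⟨by simp, b ▸ (hk (j + 1)).inc_left⟩⟩
      · refine ⟨j - 1, Or.inl ⟨by simp, ?_⟩⟩
        have h1 := (hk (j - 1)).inc_right
        rw [sub_add_cancel] at h1
        exact a ▸ h1
    obtain ⟨k, ⟨hkj, hinc⟩ | rfl⟩ := key
    · obtain ⟨l, hl'⟩ := hDC ⟨k, rfl⟩
      rw [← hl'] at hinc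
      rcases hinc.eq_or_eq_of_isLink (hl l) with h1 | h1
      · rw [hv h1, hl']
        exact ⟨k, rfl⟩
      · have h2 := add_right_cancel (hv h1)
        exact absurd (hf (hl'.symm.trans (h2 ▸ hj.symm))) hkj
    · rw [show i + 1 = i from (Fin.subsingleton_one).elim _ _]
      exact ⟨j, hj⟩
  obtain ⟨i₀, hi₀⟩ := hDC ⟨0, rfl⟩
  have all : ∀ t : ℕ, e (i₀ + (t : Fin (n + 1))) ∈ Set.range f := by
    intro t
    induction t with
    | zero => simp [hi₀]
    | succ t ih => simpa [add_assoc] using step _ ih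
  rintro _ ⟨i, rfl⟩
  simpa using all ((i - i₀ : Fin (n + 1)) : ℕ)

/-- The circuits of the cycle matroid of `G` are the circles of `G`. -/
theorem Graph.cycleMatroid_isCircuit {V E : Type*} (G : Graph V E) (C : Set E) :
    G.cycleMatroid.IsCircuit C ↔ G.IsCircle C := by
  have hsub : ∀ D, G.IsCircle D → D ⊆ G.edgeSet := by
    rintro _ ⟨n, v, e, -, -, hl, rfl⟩ _ ⟨i, rfl⟩
    exact (hl i).edge_mem
  have hdep : ∀ D, G.cycleMatroid.Dep D ↔ D ⊆ G.edgeSet ∧ ∃ C, C ⊆ D ∧ G.IsCircle C := by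
    intro D
    rw [Matroid.Dep, G.cycleMatroid_indep, G.cycleMatroid_E, Graph.IsForestSet]
    constructor
    · rintro ⟨h1, h2⟩
      by_contra! h3
      exact h1 ⟨h2, h3 h2⟩
    · rintro ⟨h1, C, hC, hC'⟩
      exact ⟨fun h => h.2 C hC hC', h1⟩
  constructor
  · intro h
    obtain ⟨hE, D, hDC, hD⟩ := (hdep C).1 h.1
    have : C ⊆ D := h.2 ((hdep D).2 ⟨hsub D hD, D, subset_rfl, hD⟩) hDC
    rwa [this.antisymm hDC]
  · intro h
    refine ⟨(hdep C).2 ⟨hsub C h, C, subset_rfl, h⟩, fun D hD hDC => ?_⟩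
    obtain ⟨-, B, hBD, hB⟩ := (hdep D).1 hD
    rw [← hB.eq_of_subset h (hBD.trans hDC)]
    exact hBD

/-- Two matroids are isomorphic if a bijection between their ground sets preserves and reflects
independence. -/
def Matroid.IsIsomorphic {α β : Type*} (M : Matroid α) (N : Matroid β) : Prop :=
  ∃ ψ : M.E ≃ N.E, ∀ X : Set M.E,
    M.Indep (Subtype.val '' X) ↔ N.Indep (Subtype.val '' (ψ '' X))

/-- A matroid is graphic if it is isomorphic to the cycle matroid of a finite multigraph without
loops (parallel edges are allowed). -/
def Matroid.IsGraphic {α : Type*} (M : Matroid α) : Prop :=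
  ∃ (V E : Type) (G : Graph V E), G.vertexSet.Finite ∧ G.edgeSet.Finite ∧ G.Loopless ∧
    M.IsIsomorphic G.cycleMatroid

/-- A matroid is cographic if its dual is graphic. -/
def Matroid.IsCographic {α : Type*} (M : Matroid α) : Prop :=
  Matroid.IsGraphic (Matroid.dual M)

/-- The complete bipartite graph `K_{m,n}`, as a multigraph. -/
def Graph.completeBipartite (m n : ℕ) : Graph (Fin m ⊕ Fin n) (Sym2 (Fin m ⊕ Fin n)) :=
  Graph.ofSimpleGraph (completeBipartiteGraph (Fin m) (Fin n))

/-!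
Deleting a cocircuit `Y` from `M*(G)` is dual to contracting the circle `Y` of `G`, so the claim
says that `G / Y` has a planar dual graph when `G` is `K_{3,5}` or `K_{4,4}` without an edge. In the
spirit of MacLane's planarity criterion, the dual graph is described by a two-basis: even subgraphs
`S w` of `G` that generate its cycle space, such that each edge outside `Y` lies in exactly two of
them. They are the faces of `G / Y`, completed by edges of `Y` to even subgraphs of `G`.

Let `y e` be the vector over the two-element field recording which `S w` contain `e`. Its relations
`∑ c e • y e = 0` are the labellings `c` orthogonal to the cycle space, that is, the cuts of `G`
(`IsTwoBasis.sum_smul_eq_zero_iff`), and linear algebra shows that `y` represents `M*(G)`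
(`linearIndepOn_iff_mem_span_compl`, `Matroid.dual_indep_image_iff`). Outside `Y` each `y e` is a
sum of two unit vectors, i.e. an incidence vector of a graph whose vertices are the indices `w`, so
`M*(G) \ Y` is graphic (`IsTwoBasis.isGraphic_delete`).

For `K_{4,4}` without an edge `e`, two-bases of `K_{4,4}` itself suffice: deleting `e` from the
graph contracts `e` in the dual graph (`linearIndepOn_mapDomain_iff`), and no loop arises because
the dual graph has no other edge parallel to `e`.

Up to renumbering the two sides of `K_{m,n}`, a circle is determined by its length
(`Graph.IsCircle.exists_bipartiteCycle`). This leaves circles of length 4 and 6 in `K_{3,5}` and of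
length 4, 6 and 8 in `K_{4,4}`, for which explicit two-bases are checked by evaluation.
-/

open scoped Matroid

/-! ### Isomorphism of matroids -/

theorem Matroid.IsIsomorphic.trans {α β γ : Type*} {M : Matroid α} {N : Matroid β} {P : Matroid γ}
    (h : M.IsIsomorphic N) (h' : N.IsIsomorphic P) : M.IsIsomorphic P := by
  obtain ⟨ψ, hψ⟩ := h
  obtain ⟨χ, hχ⟩ := h'
  refine ⟨ψ.trans χ, fun X => ?_⟩
  rw [hψ, hχ, Equiv.coe_trans, Set.image_comp]

theorem Matroid.IsGraphic.of_isIsomorphic {α β : Type*} {M : Matroid α} {N : Matroid β}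
    (hN : N.IsGraphic) (h : M.IsIsomorphic N) : M.IsGraphic := by
  obtain ⟨V, E, G, hV, hE, hG, hiso⟩ := hN
  exact ⟨V, E, G, hV, hE, hG, h.trans hiso⟩

theorem Matroid.dual_indep_image_iff_of_equiv {α β : Type*} {M : Matroid α} {N : Matroid β}
    (ψ : M.E ≃ N.E)
    (hψ : ∀ X : Set M.E, M.Indep (Subtype.val '' X) ↔ N.Indep (Subtype.val '' (ψ '' X)))
    (X : Set M.E) :
    M✶.Indep (Subtype.val '' X) ↔ N✶.Indep (Subtype.val '' (ψ '' X)) := by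
  have h : (M.restrictSubtype M.E).mapEquiv ψ = N.restrictSubtype N.E := by
    refine Matroid.ext_indep (by simp) fun I _ => ?_
    rw [Matroid.mapEquiv_indep_iff, Matroid.restrictSubtype_indep_iff,
      Matroid.restrictSubtype_indep_iff, hψ, ψ.image_symm_image]
  have hdual : (M✶.restrictSubtype M.E).mapEquiv ψ = N✶.restrictSubtype N.E := by
    rw [← Matroid.restrictSubtype_dual, ← Matroid.restrictSubtype_dual, ← h,
      Matroid.mapEquiv_eq_map, Matroid.mapEquiv_eq_map, Matroid.map_dual]
  have h2 : ((M✶.restrictSubtype M.E).mapEquiv ψ).Indep (ψ '' X) ↔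
      (N✶.restrictSubtype N.E).Indep (ψ '' X) := by rw [hdual]
  rwa [Matroid.mapEquiv_indep_iff, Matroid.restrictSubtype_indep_iff,
    Matroid.restrictSubtype_indep_iff, ψ.symm_image_image] at h2

theorem Matroid.isCircuit_image_of_equiv {α β : Type*} {M : Matroid α} {N : Matroid β}
    (ψ : M.E ≃ N.E)
    (hψ : ∀ X : Set M.E, M.Indep (Subtype.val '' X) ↔ N.Indep (Subtype.val '' (ψ '' X)))
    {X : Set M.E} (hX : M.IsCircuit (Subtype.val '' X)) :
    N.IsCircuit (Subtype.val '' (ψ '' X)) := by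
  rw [Matroid.isCircuit_iff_forall_ssubset] at hX ⊢
  refine ⟨⟨fun h => hX.1.not_indep ((hψ X).2 h), by simp⟩, fun I hI => ?_⟩
  have hIE : I ⊆ N.E := hI.subset.trans (by simp)
  have hI' : Subtype.val '' (ψ '' (ψ.symm '' (Subtype.val ⁻¹' I))) = I := by
    rw [ψ.image_symm_image, Subtype.image_preimage_coe, Set.inter_eq_right.2 hIE]
  rw [← hI', ← hψ]
  refine hX.2 ?_
  rw [← hI', ← Set.image_comp, ← Set.image_comp _ _ X,
    (Subtype.val_injective.comp ψ.injective).injOn.image_ssubset_image_iff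
      (Set.subset_univ _) (Set.subset_univ _)] at hI
  exact Subtype.val_injective.image_strictMono hI

theorem Matroid.delete_isIsomorphic_of_equiv {α β : Type*} {M : Matroid α} {N : Matroid β}
    (ψ : M.E ≃ N.E)
    (hψ : ∀ X : Set M.E, M.Indep (Subtype.val '' X) ↔ N.Indep (Subtype.val '' (ψ '' X)))
    (X : Set M.E) :
    (M ＼ (Subtype.val '' X)).IsIsomorphic (N ＼ (Subtype.val '' (ψ '' X))) := by
  have hmem : ∀ x : M.E, (x : α) ∈ M.E \ Subtype.val '' X ↔
      (ψ x : β) ∈ N.E \ Subtype.val '' (ψ '' X) := by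
    intro x
    simp
  let χ : (M ＼ (Subtype.val '' X)).E ≃ (N ＼ (Subtype.val '' (ψ '' X))).E :=
    { toFun := fun x => ⟨ψ ⟨x, x.2.1⟩, (hmem ⟨x, x.2.1⟩).1 x.2⟩
      invFun := fun y => ⟨ψ.symm ⟨y, y.2.1⟩, (hmem _).2 (by simpa using y.2)⟩
      left_inv := fun x => Subtype.ext (by simp)
      right_inv := fun y => Subtype.ext (by simp) }
  refine ⟨χ, fun Z => ?_⟩
  have h1 : Disjoint (Subtype.val '' Z) (Subtype.val '' X) :=
    Set.disjoint_left.2 fun a ⟨z, _, hz⟩ ha => z.2.2 (hz ▸ ha)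
  have h2 : Disjoint (Subtype.val '' (χ '' Z)) (Subtype.val '' (ψ '' X)) :=
    Set.disjoint_left.2 fun a ⟨z, _, hz⟩ ha => z.2.2 (hz ▸ ha)
  have h3 : Subtype.val '' Z =
      Subtype.val '' ((fun z => ⟨z, z.2.1⟩ : (M ＼ (Subtype.val '' X)).E → M.E) '' Z) := by
    rw [Set.image_image]
  have h4 : Subtype.val '' (χ '' Z) = Subtype.val ''
      (ψ '' ((fun z => ⟨z, z.2.1⟩ : (M ＼ (Subtype.val '' X)).E → M.E) '' Z)) := by
    simp only [Set.image_image]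
    rfl
  rw [Matroid.delete_indep_iff, Matroid.delete_indep_iff, and_iff_left h1, and_iff_left h2, h3,
    hψ, h4]

/-- Graphicness of the matroids obtained by deleting cocircuits passes along isomorphisms. -/
theorem Matroid.IsIsomorphic.isGraphic_delete_isCocircuit {α β : Type*} {M : Matroid α}
    {N : Matroid β} (h : M.IsIsomorphic N)
    (hN : ∀ K, N.IsCocircuit K → (N ＼ K).IsGraphic) {K : Set α} (hK : M.IsCocircuit K) :
    (M ＼ K).IsGraphic := by
  obtain ⟨ψ, hψ⟩ := h
  obtain ⟨X, rfl⟩ : ∃ X : Set M.E, K = Subtype.val '' X :=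
    ⟨Subtype.val ⁻¹' K, by rw [Subtype.image_preimage_coe, Set.inter_eq_right.2 hK.subset_ground]⟩
  exact (hN _ (Matroid.isCircuit_image_of_equiv (M := M✶) (N := N✶) ψ
    (Matroid.dual_indep_image_iff_of_equiv ψ hψ) hK)).of_isIsomorphic
    (Matroid.delete_isIsomorphic_of_equiv ψ hψ X)

/-! ### Binary representations -/

/-- In a matroid represented by vectors, the closure is given by the linear span. -/
theorem Matroid.mem_closure_iff_mem_span {K V β : Type*} [Field K] [AddCommGroup V] [Module K V]
    {N : Matroid β} {x : β → V} (hN : ∀ I, N.Indep I ↔ I ⊆ N.E ∧ LinearIndepOn K x I)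
    {X : Set β} (hX : X ⊆ N.E) {e : β} (he : e ∈ N.E) :
    e ∈ N.closure X ↔ x e ∈ Submodule.span K (x '' X) := by
  have key : ∀ I, N.Indep I → ∀ e ∈ N.E,
      (e ∈ N.closure I ↔ x e ∈ Submodule.span K (x '' I)) := by
    intro I hI e he
    rw [hI.mem_closure_iff', ((hN I).1 hI).2.mem_span_iff, hN, Set.insert_subset_iff,
      and_iff_right he, and_iff_right he, and_iff_right hI.subset_ground]
  obtain ⟨I, hI⟩ := N.exists_isBasis X
  have hspan : Submodule.span K (x '' I) = Submodule.span K (x '' X) := by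
    refine le_antisymm (Submodule.span_mono (Set.image_mono hI.subset)) (Submodule.span_le.2 ?_)
    rintro _ ⟨a, ha, rfl⟩
    exact (key I hI.indep a (hX ha)).1 (hI.subset_closure ha)
  rw [← hI.closure_eq_closure, key I hI.indep e he, hspan]

/-- If the linear relations among the vectors `y i` are exactly the families `i ↦ f (x i)` for
linear forms `f`, then `y` is independent on `J` precisely when `x` takes its whole span on the
complement of `J`. -/
theorem linearIndepOn_iff_mem_span_compl {K V W ι : Type*} [Field K] [AddCommGroup V] [Module K V]
    [AddCommGroup W] [Module K W] [Fintype ι] {x : ι → V} {y : ι → W}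
    (h : ∀ c : ι → K, ∑ i, c i • y i = 0 ↔ ∃ f : V →ₗ[K] K, ∀ i, c i = f (x i)) (J : Set ι) :
    LinearIndepOn K y J ↔ ∀ i, x i ∈ Submodule.span K (x '' Jᶜ) := by
  classical
  constructor
  · intro hJ i
    by_contra hi
    -- A linear form vanishing on the span but not at `x i` is a relation of `y` supported on `J`.
    obtain ⟨f, hf, hf'⟩ := Submodule.exists_le_ker_of_notMem hi
    have hz : ∀ j, j ∉ J → f (x j) = 0 := fun j hj => hf' (Submodule.subset_span ⟨j, hj, rfl⟩)
    have h0 := (h fun i => f (x i)).2 ⟨f, fun _ => rfl⟩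
    rw [linearIndepOn_iff'] at hJ
    have hsum : ∑ j ∈ Finset.univ.filter (· ∈ J), f (x j) • y j = 0 := by
      rw [Finset.sum_filter_of_ne]
      · exact h0
      · intro j _ hj
        by_contra hjJ
        exact hj (by rw [hz j hjJ, zero_smul])
    have := hJ _ _ (by simp) hsum
    by_cases hiJ : i ∈ J
    · exact hf (this i (by simpa using hiJ))
    · exact hf (hz i hiJ)
  · intro hJ
    rw [linearIndepOn_iff'']
    intro t c htJ hct hsum i _
    -- A relation of `y` supported on `J` is a linear form vanishing on the span, so it is zero.
    obtain ⟨f, hf⟩ := (h c).1 (by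
      rw [← hsum, Finset.sum_subset (Finset.subset_univ t)]
      intro j _ hj
      rw [hct j hj, zero_smul])
    have hker : Submodule.span K (x '' Jᶜ) ≤ LinearMap.ker f := by
      rw [Submodule.span_le]
      rintro _ ⟨j, hj, rfl⟩
      exact (hf j).symm.trans (hct j fun hjt => hj (htJ hjt))
    exact (hf i).trans (hker (hJ i))

/-- Let `x` represent `N`, whose elements are indexed by the complement of `T`, and let the relations
among the vectors `y i` be the families `f (x i)` for linear forms `f`. Then `N✶` is represented by
`y` after contracting `T`. -/
theorem Matroid.dual_indep_image_iff {K V W ι β : Type*} [Field K] [AddCommGroup V] [Module K V]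
    [AddCommGroup W] [Module K W] [Fintype ι] {N : Matroid β} {x : β → V}
    (hN : ∀ I, N.Indep I ↔ I ⊆ N.E ∧ LinearIndepOn K x I) {φ : ι → β} (hφ : φ.Injective)
    {T : Set ι} (hE : N.E = φ '' Tᶜ) {y : ι → W}
    (h : ∀ c : ι → K, ∑ i, c i • y i = 0 ↔ ∃ f : V →ₗ[K] K, ∀ i, c i = f (x (φ i)))
    (hT : LinearIndepOn K y T) {I : Set ι} (hI : Disjoint I T) :
    N✶.Indep (φ '' I) ↔ LinearIndepOn K y (I ∪ T) := by
  have hIE : φ '' I ⊆ N.E := by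
    rw [hE]
    exact Set.image_mono (Set.subset_compl_iff_disjoint_right.2 hI)
  have hdiff : N.E \ φ '' I = φ '' (I ∪ T)ᶜ := by
    rw [hE, ← Set.image_sdiff hφ, Set.compl_union, Set.inter_comm, Set.sdiff_eq_compl_inter,
      Set.inter_comm]
  rw [← Matroid.coindep_def, Matroid.coindep_iff_compl_spanning hIE,
    Matroid.spanning_iff_ground_subset_closure, linearIndepOn_iff_mem_span_compl h, hdiff]
  have hcl : ∀ i ∉ T, (φ i ∈ N.closure (φ '' (I ∪ T)ᶜ) ↔
      x (φ i) ∈ Submodule.span K ((fun i => x (φ i)) '' (I ∪ T)ᶜ)) := by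
    intro i hi
    rw [Matroid.mem_closure_iff_mem_span hN (hdiff ▸ Set.sdiff_subset) (hE ▸ ⟨i, hi, rfl⟩),
      Set.image_image]
  constructor
  · intro hsp i
    have hout : ∀ i ∉ T, x (φ i) ∈ Submodule.span K ((fun i => x (φ i)) '' (I ∪ T)ᶜ) :=
      fun i hi => (hcl i hi).1 (hsp (hE ▸ ⟨i, hi, rfl⟩))
    refine Submodule.span_le.2 ?_ ((linearIndepOn_iff_mem_span_compl h T).1 hT i)
    rintro _ ⟨j, hj, rfl⟩
    exact hout j hj
  · intro hsp
    rw [hE]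
    rintro _ ⟨i, hi, rfl⟩
    exact (hcl i hi).2 (hsp i)

/-- A matroid represented over the two-element field by vectors that are sums of two distinct
unit vectors is graphic: the vectors are the incidence vectors of a graph. -/
theorem Matroid.isGraphic_of_pairs {β : Type*} {ι W : Type} [Finite ι] [Finite W] {M : Matroid β}
    {φ : ι → β} (hφ : φ.Injective) {D : Set ι} (hE : M.E = φ '' D) {p q : ι → W}
    (hpq : ∀ i ∈ D, p i ≠ q i)
    (h : ∀ I ⊆ D, (M.Indep (φ '' I) ↔ LinearIndepOn (ZMod 2)
      (fun i => (Finsupp.single (p i) 1 + Finsupp.single (q i) 1 : W →₀ ZMod 2)) I)) :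
    M.IsGraphic := by
  let H : Graph W ι :=
    { vertexSet := Set.univ
      IsLink := fun e x y => e ∈ D ∧ s(p e, q e) = s(x, y)
      edgeSet := D
      isLink_symm := fun e _ => ⟨fun x y h => ⟨h.1, h.2.trans Sym2.eq_swap⟩⟩
      eq_or_eq_of_isLink_of_isLink := by
        rintro e x y v w ⟨-, h1⟩ ⟨-, h2⟩
        rw [h1] at h2
        rcases Sym2.eq_iff.1 h2 with h | h
        exacts [Or.inl h.1, Or.inr h.1]
      edge_mem_iff_exists_isLink := fun e =>
        ⟨fun he => ⟨_, _, he, rfl⟩, fun ⟨_, _, he, _⟩ => he⟩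
      left_mem_of_isLink := fun _ _ _ _ => Set.mem_univ _ }
  have hlink : ∀ i ∈ D, H.IsLink i (p i) (q i) := fun i hi => ⟨hi, rfl⟩
  refine ⟨W, ι, H, Set.toFinite _, Set.toFinite _, ⟨fun e x hx => ?_⟩, ?_⟩
  · obtain ⟨he, hx⟩ : e ∈ D ∧ s(p e, q e) = s(x, x) := hx
    rcases Sym2.eq_iff.1 hx with h | h <;> exact hpq e he (h.1.trans h.2.symm)
  · let ψ : M.E ≃ H.edgeSet := (Equiv.setCongr hE).trans (Equiv.Set.image φ D hφ).symm
    have hψ : ∀ a : M.E, φ (ψ a) = a := by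
      rintro ⟨a, ha⟩
      obtain ⟨i, hi, rfl⟩ := hE ▸ ha
      have : ψ ⟨φ i, ha⟩ = ⟨i, hi⟩ := by
        simp only [ψ, Equiv.trans_apply, Equiv.setCongr_apply]
        exact (Equiv.Set.image φ D hφ).symm_apply_apply ⟨i, hi⟩
      rw [this]
    refine ⟨ψ, fun X => ?_⟩
    have hD : Subtype.val '' (ψ '' X) ⊆ D := by
      rintro _ ⟨⟨i, hi⟩, -, rfl⟩
      exact hi
    have hX : Subtype.val '' X = φ '' (Subtype.val '' (ψ '' X)) := by
      simp only [Set.image_image, hψ]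
    rw [Graph.cycleMatroid_indep, Graph.isForestSet_iff_linearIndepOn, hX, h _ hD]
    exact (linearIndepOn_congr fun i hi => ((hlink i (hD hi)).incVec_eq).symm).trans
      (and_iff_right hD).symm

/-- Identifying `q₀` with `p₀` contracts an element represented by the sum of the unit vectors at
`p₀` and `q₀`. -/
theorem linearIndepOn_mapDomain_iff {ι W : Type*} [DecidableEq W] {y : ι → W →₀ ZMod 2} {e : ι}
    {p₀ q₀ : W} (hne : p₀ ≠ q₀) (he : y e = Finsupp.single p₀ 1 + Finsupp.single q₀ 1)
    {I : Set ι} (heI : e ∉ I) :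
    LinearIndepOn (ZMod 2)
        (fun i => (y i).mapDomain (fun w => if w = q₀ then p₀ else w)) I ↔
      LinearIndepOn (ZMod 2) y (insert e I) := by
  set π : W → W := fun w => if w = q₀ then p₀ else w with hπ
  let L : (W →₀ ZMod 2) →ₗ[ZMod 2] (W →₀ ZMod 2) := Finsupp.lmapDomain (ZMod 2) (ZMod 2) π
  have h2 : ∀ (w : W) (a : ZMod 2), Finsupp.single w a + Finsupp.single w a = 0 := fun w a => by
    rw [← Finsupp.single_add, CharTwo.add_self_eq_zero, Finsupp.single_zero]
  have hLe : L (y e) = 0 := by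
    simp only [L, Finsupp.lmapDomain_apply, he, Finsupp.mapDomain_add, Finsupp.mapDomain_single]
    simp only [hπ, if_neg hne, if_true, h2]
  -- The kernel of `L` is spanned by `y e`.
  have hL : ∀ g, g = L g + g q₀ • y e := by
    intro g
    induction g using Finsupp.induction_linear with
    | zero => simp
    | add f g hf hg =>
      rw [map_add, Finsupp.add_apply, add_smul, add_add_add_comm, ← hf, ← hg]
    | single w a =>
      simp only [L, Finsupp.lmapDomain_apply, Finsupp.mapDomain_single, hπ]
      by_cases hw : w = q₀
      · subst hw
        simp [he, ← add_assoc, h2]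
      · simp [hw]
  have hye : y e ≠ 0 := fun h0 => by
    have := DFunLike.congr_fun (he.symm.trans h0) p₀
    simp [hne] at this
  rw [linearIndepOn_insert heI]
  constructor
  · intro h
    refine ⟨LinearIndepOn.of_comp L h, fun hspan => hye ?_⟩
    have hdisj := Submodule.range_ker_disjoint (f := L) (v := fun i : I => y i) h
    refine Submodule.disjoint_def.1 hdisj _ ?_ hLe
    rwa [Set.image_eq_range] at hspan
  · rintro ⟨hI, hspan⟩
    refine LinearIndependent.map (f := L) (v := fun i : I => y i) hI
      (Submodule.disjoint_def.2 fun g hg hg0 => ?_)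
    have hg' := hL g
    rw [LinearMap.mem_ker.1 hg0, zero_add] at hg'
    by_cases hq : g q₀ = 0
    · rw [hg', hq, zero_smul]
    · rw [Set.image_eq_range] at hspan
      refine absurd ((Submodule.smul_mem_iff _ hq).1 ?_) hspan
      rwa [← hg']

/-! ### Complete bipartite graphs and their circles -/

/-- The edge of `K_{m,n}` joining the vertices numbered `e.1` and `e.2` when the two sides are
renumbered by the permutations `σ` and `τ`. -/
def bipartiteEdge {m n : ℕ} (σ : Equiv.Perm (Fin m)) (τ : Equiv.Perm (Fin n))
    (e : Fin m × Fin n) : Sym2 (Fin m ⊕ Fin n) :=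
  s(Sum.inl (σ e.1), Sum.inr (τ e.2))

/-- The edges of the cycle `a₀ b₀ a₁ b₁ … aₜ₋₁ bₜ₋₁ a₀` of length `2 * t` in `K_{m,n}`. -/
def bipartiteCycle (m n t : ℕ) : Finset (Fin m × Fin n) :=
  Finset.univ.filter fun e =>
    (e.2 : ℕ) < t ∧ ((e.1 : ℕ) = e.2 ∨ (e.1 : ℕ) = ((e.2 : ℕ) + 1) % t)

theorem bipartiteEdge_injective {m n : ℕ} (σ : Equiv.Perm (Fin m)) (τ : Equiv.Perm (Fin n)) :
    (bipartiteEdge σ τ).Injective := by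
  rintro ⟨a, b⟩ ⟨c, d⟩ h
  rcases Sym2.eq_iff.1 h with h | h
  · simpa using h
  · simp at h

theorem isLink_bipartiteEdge {m n : ℕ} (σ : Equiv.Perm (Fin m)) (τ : Equiv.Perm (Fin n))
    (e : Fin m × Fin n) : (Graph.completeBipartite m n).IsLink (bipartiteEdge σ τ e)
      (Sum.inl (σ e.1)) (Sum.inr (τ e.2)) := by
  simp [Graph.completeBipartite, bipartiteEdge]

theorem edgeSet_completeBipartite {m n : ℕ} (σ : Equiv.Perm (Fin m)) (τ : Equiv.Perm (Fin n)) :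
    (Graph.completeBipartite m n).edgeSet = Set.range (bipartiteEdge σ τ) := by
  refine Set.Subset.antisymm (fun e he => ?_) ?_
  · obtain ⟨x, y, rfl, hxy⟩ := Graph.exists_isLink_of_mem_edgeSet he
    rcases x with a | b <;> rcases y with c | d <;> simp at hxy
    · exact ⟨(σ.symm a, τ.symm d), by simp [bipartiteEdge]⟩
    · exact ⟨(σ.symm c, τ.symm b), by simp [bipartiteEdge, Sym2.eq_swap]⟩
  · rintro _ ⟨e, rfl⟩
    exact (isLink_bipartiteEdge σ τ e).edge_mem

/-- A circle of a complete bipartite graph can be traversed starting from the left side, with the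
sides alternating. -/
theorem Graph.IsCircle.exists_isLeft {m n : ℕ} {C : Set (Sym2 (Fin m ⊕ Fin n))}
    (hC : (Graph.completeBipartite m n).IsCircle C) :
    ∃ (k : ℕ) (v : Fin (k + 1) → Fin m ⊕ Fin n) (e : Fin (k + 1) → Sym2 (Fin m ⊕ Fin n)),
      v.Injective ∧ e.Injective ∧ (∀ i, e i = s(v i, v (i + 1))) ∧
        (∀ i, (v (i + 1)).isLeft = !(v i).isLeft) ∧ (v 0).isLeft ∧ C = Set.range e := by
  obtain ⟨k, v, e, hv, he, hl, rfl⟩ := hC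
  have hs : ∀ i, e i = s(v i, v (i + 1)) := fun i => (hl i).1
  have hside : ∀ i, (v (i + 1)).isLeft = !(v i).isLeft := by
    intro i
    have h := (hl i).2
    rw [hs i] at h
    cases hx : v i <;> cases hy : v (i + 1) <;> simp [hx, hy] at h ⊢
  by_cases h0 : (v 0).isLeft
  · exact ⟨k, v, e, hv, he, hs, hside, h0, rfl⟩
  · refine ⟨k, fun i => v (i + 1), fun i => e (i + 1), hv.comp (add_left_injective 1),
      he.comp (add_left_injective 1), fun i => hs _, fun i => hside _, ?_, ?_⟩
    · rw [hside, Bool.eq_false_of_not_eq_true h0, Bool.not_false]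
    · exact ((Equiv.addRight (1 : Fin (k + 1))).surjective.range_comp e).symm

/-- Up to renumbering the two sides, every circle of `K_{m,n}` is a standard one. -/
theorem Graph.IsCircle.exists_bipartiteCycle {m n : ℕ} {C : Set (Sym2 (Fin m ⊕ Fin n))}
    (hC : (Graph.completeBipartite m n).IsCircle C) :
    ∃ t, 2 ≤ t ∧ t ≤ m ∧ t ≤ n ∧ ∃ (σ : Equiv.Perm (Fin m)) (τ : Equiv.Perm (Fin n)),
      C = bipartiteEdge σ τ '' (bipartiteCycle m n t : Set (Fin m × Fin n)) := by
  obtain ⟨k, v, e, hv, he, hs, hside, h0, rfl⟩ := hC.exists_isLeft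
  have hsucc : ∀ j, Fin.ofNat (k + 1) j + 1 = Fin.ofNat (k + 1) (j + 1) := by
    intro j
    apply Fin.ext
    simp [Fin.val_add]
  -- The sides alternate, so a closed walk has even length `2 * t`.
  have hpar : ∀ j, (v (Fin.ofNat (k + 1) j)).isLeft = decide (j % 2 = 0) := by
    intro j
    induction j with
    | zero => simpa using h0
    | succ j ih =>
      rw [← hsucc, hside, ih, ← decide_not]
      exact decide_eq_decide.2 (by omega)
  obtain ⟨t, ht⟩ : ∃ t, k + 1 = 2 * t := by
    have h1 := hpar (k + 1)
    have h2 : Fin.ofNat (k + 1) (k + 1) = 0 := Fin.ext (by simp)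
    rw [h2, h0] at h1
    have := of_decide_eq_true h1.symm
    exact ⟨(k + 1) / 2, by omega⟩
  -- Length two would need two parallel edges.
  have ht2 : 2 ≤ t := by
    by_contra hlt
    obtain rfl : k = 1 := by omega
    have h01 : e 0 = e 1 := by
      rw [hs 0, hs 1, Sym2.eq_swap]
      rfl
    exact absurd (he h01) (by decide)
  have hleft : ∀ j, ∃ a, v (Fin.ofNat (k + 1) (2 * j)) = Sum.inl a := fun j =>
    Sum.isLeft_iff.1 (by rw [hpar]; simp)
  have hright : ∀ j, ∃ b, v (Fin.ofNat (k + 1) (2 * j + 1)) = Sum.inr b := fun j =>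
    Sum.isRight_iff.1 (by rw [← Sum.not_isLeft, hpar]; simp)
  choose a ha using hleft
  choose b hb using hright
  have hmod : ∀ i j, Fin.ofNat (k + 1) i = Fin.ofNat (k + 1) j ↔ i % (2 * t) = j % (2 * t) := by
    intro i j
    rw [Fin.ext_iff, ← ht]
    rfl
  have haper : ∀ j, a (j % t) = a j := fun j => Sum.inl_injective (by
    rw [← ha, ← ha, (hmod _ _).2]
    rw [Nat.mul_mod_mul_left, Nat.mul_mod_mul_left, Nat.mod_mod])
  have hainj : ∀ i < t, ∀ j < t, a i = a j → i = j := fun i hi j hj h => by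
    have := (hmod _ _).1 (hv ((ha i).trans ((congrArg _ h).trans (ha j).symm)))
    rw [Nat.mod_eq_of_lt (by omega), Nat.mod_eq_of_lt (by omega)] at this
    omega
  have hbinj : ∀ i < t, ∀ j < t, b i = b j → i = j := fun i hi j hj h => by
    have := (hmod _ _).1 (hv ((hb i).trans ((congrArg _ h).trans (hb j).symm)))
    rw [Nat.mod_eq_of_lt (by omega), Nat.mod_eq_of_lt (by omega)] at this
    omega
  have hae : ∀ j, e (Fin.ofNat (k + 1) (2 * j)) = s(Sum.inl (a j), Sum.inr (b j)) := fun j => by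
    rw [hs, hsucc, ha, hb]
  have hbe : ∀ j, e (Fin.ofNat (k + 1) (2 * j + 1)) = s(Sum.inl (a (j + 1)), Sum.inr (b j)) :=
    fun j => by rw [hs, hsucc, hb, Sym2.eq_swap, ← ha (j + 1)]; rfl
  have hainj' : (fun i : Fin t => a i).Injective :=
    fun i j h => Fin.ext (hainj i i.2 j j.2 h)
  have hbinj' : (fun i : Fin t => b i).Injective :=
    fun i j h => Fin.ext (hbinj i i.2 j j.2 h)
  have htm : t ≤ m := by simpa using Fintype.card_le_of_injective _ hainj'
  have htn : t ≤ n := by simpa using Fintype.card_le_of_injective _ hbinj'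
  obtain ⟨σ, hσ⟩ := Equiv.Perm.exists_extending_pair (Fin.castLE htm) _
    (Fin.castLE_injective htm) hainj'
  obtain ⟨τ, hτ⟩ := Equiv.Perm.exists_extending_pair (Fin.castLE htn) _
    (Fin.castLE_injective htn) hbinj'
  have hσ' : ∀ i : Fin m, (i : ℕ) < t → σ i = a i := fun i hi => hσ ⟨i, hi⟩
  have hτ' : ∀ i : Fin n, (i : ℕ) < t → τ i = b i := fun i hi => hτ ⟨i, hi⟩
  refine ⟨t, ht2, htm, htn, σ, τ, Set.Subset.antisymm ?_ ?_⟩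
  · rintro _ ⟨i, rfl⟩
    have hi : (i : ℕ) < 2 * t := ht ▸ i.2
    obtain ⟨j, hj | hj⟩ := Nat.even_or_odd' (i : ℕ)
    · have hjt : j < t := by omega
      have hij : i = Fin.ofNat (k + 1) (2 * j) := Fin.ext (by rw [← hj]; simp)
      refine ⟨(⟨j, by omega⟩, ⟨j, by omega⟩), by simp [bipartiteCycle, hjt], ?_⟩
      exact .trans (by rw [bipartiteEdge, hσ' _ hjt, hτ' _ hjt])
        ((hae j).symm.trans (congrArg e hij.symm))
    · have hjt : j < t := by omega
      have hij : i = Fin.ofNat (k + 1) (2 * j + 1) :=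
        Fin.ext (by rw [← hj]; simp)
      have hmt : (j + 1) % t < t := Nat.mod_lt _ (by omega)
      refine ⟨(⟨(j + 1) % t, by omega⟩, ⟨j, by omega⟩), by simp [bipartiteCycle, hjt], ?_⟩
      exact .trans (by rw [bipartiteEdge, hσ' _ hmt, hτ' _ hjt, haper (j + 1)])
        ((hbe j).symm.trans (congrArg e hij.symm))
  · rintro _ ⟨⟨p, q⟩, hpq, rfl⟩
    obtain ⟨hq, hp | hp⟩ : (q : ℕ) < t ∧ ((p : ℕ) = q ∨ (p : ℕ) = ((q : ℕ) + 1) % t) := by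
      simpa [bipartiteCycle] using hpq
    · refine ⟨Fin.ofNat (k + 1) (2 * q), ?_⟩
      rw [hae, bipartiteEdge, hσ' p (hp ▸ hq), hτ' q hq, hp]
    · refine ⟨Fin.ofNat (k + 1) (2 * q + 1), ?_⟩
      rw [hbe, bipartiteEdge, hσ' p (hp ▸ Nat.mod_lt _ (by omega)), hτ' q hq, hp, haper]

/-! ### Two-bases of the cycle space -/

/-- The sets `S w` of edges of `K_{m+1,n+1}` form a two-basis outside `C`: each `S w` is an even
subgraph, together they generate the cycle space, and every edge outside `C` lies in exactly two of
them. Generation is expressed for the four-cycles through the edge `(0, 0)`, which span the cycle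
space; these are written so that they degenerate to `0` when `i = 0` or `j = 0`. -/
structure IsTwoBasis {m n l : ℕ} (C : Finset (Fin (m + 1) × Fin (n + 1)))
    (S : Fin l → Finset (Fin (m + 1) × Fin (n + 1))) : Prop where
  even_left : ∀ w i, Even ((S w).filter fun e => e.1 = i).card
  even_right : ∀ w j, Even ((S w).filter fun e => e.2 = j).card
  generates : ∃ R : Fin (m + 1) → Fin (n + 1) → Finset (Fin l), ∀ i j e,
    (((R i j).filter fun w => e ∈ S w).card : ZMod 2) =
      (if e = (0, 0) then 1 else 0) + (if e = (0, j) then 1 else 0) +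
        (if e = (i, 0) then 1 else 0) + (if e = (i, j) then 1 else 0)
  card_eq_two : ∀ e ∉ C, (Finset.univ.filter fun w => e ∈ S w).card = 2

/-- The vector recording which of the sets `S w` contain `e`. -/
noncomputable def memberVec {ι : Type*} [DecidableEq ι] {l : ℕ} (S : Fin l → Finset ι) (e : ι) :
    Fin l →₀ ZMod 2 :=
  ∑ w ∈ Finset.univ.filter (fun w => e ∈ S w), Finsupp.single w 1

theorem memberVec_apply {ι : Type*} [DecidableEq ι] {l : ℕ} (S : Fin l → Finset ι) (e : ι)
    (w : Fin l) : memberVec S e w = if e ∈ S w then 1 else 0 := by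
  simp [memberVec, Finsupp.finsetSum_apply, Finsupp.single_apply]

theorem sum_smul_memberVec_eq_zero_iff {ι : Type*} [Fintype ι] [DecidableEq ι] {l : ℕ}
    (S : Fin l → Finset ι) (c : ι → ZMod 2) :
    ∑ e, c e • memberVec S e = 0 ↔ ∀ w, ∑ e ∈ S w, c e = 0 := by
  rw [Finsupp.ext_iff]
  simp [Finsupp.finsetSum_apply, memberVec_apply]

/-- The edge labellings of `K_{m+1,n+1}` with sum `0` on each member of a two-basis are the cuts. -/
theorem IsTwoBasis.sum_smul_eq_zero_iff {m n l : ℕ} {C : Finset (Fin (m + 1) × Fin (n + 1))}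
    {S : Fin l → Finset (Fin (m + 1) × Fin (n + 1))} (hS : IsTwoBasis C S)
    (c : Fin (m + 1) × Fin (n + 1) → ZMod 2) :
    ∑ e, c e • memberVec S e = 0 ↔
      ∃ (u : Fin (m + 1) → ZMod 2) (v : Fin (n + 1) → ZMod 2), ∀ e, c e = u e.1 + v e.2 := by
  rw [sum_smul_memberVec_eq_zero_iff]
  constructor
  · intro h
    obtain ⟨R, hR⟩ := hS.generates
    have hfour : ∀ i j, c (0, 0) + c (0, j) + c (i, 0) + c (i, j) = 0 := by
      intro i j
      have h1 : ∑ e, c e * (((R i j).filter fun w => e ∈ S w).card : ZMod 2) = 0 := by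
        simp only [Finset.card_filter, Nat.cast_sum, Nat.cast_ite, Nat.cast_one, Nat.cast_zero,
          Finset.mul_sum]
        rw [Finset.sum_comm]
        refine Finset.sum_eq_zero fun w _ => ?_
        simpa using h w
      simpa [hR, mul_add, Finset.sum_add_distrib] using h1
    -- The potential is read off the spanning tree formed by the edges at the two vertices `0`.
    refine ⟨fun i => c (i, 0) + c (0, 0), fun j => c (0, j), fun ⟨i, j⟩ => ?_⟩
    have h2 := hfour i j
    rw [CharTwo.add_eq_zero] at h2
    rw [← h2]
    ring
  · rintro ⟨u, v, huv⟩ w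
    have hpar : ∀ {κ : Type} [Fintype κ] [DecidableEq κ] (f : Fin (m + 1) × Fin (n + 1) → κ)
        (g : κ → ZMod 2), (∀ k, Even ((S w).filter fun e => f e = k).card) →
        ∑ e ∈ S w, g (f e) = 0 := by
      intro κ _ _ f g hf
      rw [← Finset.sum_fiberwise (S w) f]
      refine Finset.sum_eq_zero fun k _ => ?_
      rw [Finset.sum_congr rfl fun e he => by rw [(Finset.mem_filter.1 he).2],
        Finset.sum_const, nsmul_eq_mul, (ZMod.natCast_eq_zero_iff_even).2 (hf k), zero_mul]
    simp only [huv, Finset.sum_add_distrib]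
    rw [hpar Prod.fst u (hS.even_left w), hpar Prod.snd v (hS.even_right w), add_zero]

/-- Deleting edges `F` from `K_{m+1,n+1}`, the dual of the cycle matroid is represented by the
membership vectors of a two-basis after contracting `F`. -/
theorem IsTwoBasis.dual_indep_iff {m n l : ℕ} {C : Finset (Fin (m + 1) × Fin (n + 1))}
    {S : Fin l → Finset (Fin (m + 1) × Fin (n + 1))} (hS : IsTwoBasis C S)
    (σ : Equiv.Perm (Fin (m + 1))) (τ : Equiv.Perm (Fin (n + 1)))
    {F : Set (Fin (m + 1) × Fin (n + 1))} (hF : LinearIndepOn (ZMod 2) (memberVec S) F)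
    {I : Set (Fin (m + 1) × Fin (n + 1))} (hI : Disjoint I F) :
    ((Graph.completeBipartite (m + 1) (n + 1)).deleteEdges
        (bipartiteEdge σ τ '' F)).cycleMatroid✶.Indep (bipartiteEdge σ τ '' I) ↔
      LinearIndepOn (ZMod 2) (memberVec S) (I ∪ F) := by
  set K := Graph.completeBipartite (m + 1) (n + 1)
  have hvec : ∀ e ∈ (K.deleteEdges (bipartiteEdge σ τ '' F)).edgeSet,
      (K.deleteEdges (bipartiteEdge σ τ '' F)).incVec e = K.incVec e := by
    intro e he
    obtain ⟨x, y, hxy⟩ := Graph.exists_isLink_of_mem_edgeSet he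
    rw [hxy.incVec_eq, ((Graph.deleteEdges_isLink ..).mp hxy).1.incVec_eq]
  refine Matroid.dual_indep_image_iff (x := K.incVec) (fun I => ?_) (bipartiteEdge_injective σ τ)
    ?_ (fun c => ?_) hF hI
  · rw [Graph.cycleMatroid_indep, Graph.isForestSet_iff_linearIndepOn, Graph.cycleMatroid_E]
    exact and_congr_right fun hIE => linearIndepOn_congr fun e he => hvec e (hIE he)
  · rw [Graph.cycleMatroid_E, Graph.edgeSet_deleteEdges, edgeSet_completeBipartite σ τ,
      ← Set.image_univ, ← Set.image_sdiff (bipartiteEdge_injective σ τ), Set.compl_eq_univ_sdiff]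
  · rw [hS.sum_smul_eq_zero_iff]
    simp only [(isLink_bipartiteEdge σ τ _).incVec_eq, map_add, K]
    constructor
    · rintro ⟨u, v, huv⟩
      exact ⟨Finsupp.linearCombination (ZMod 2) (Sum.elim (u ∘ σ.symm) (v ∘ τ.symm)),
        fun e => by simp [huv]⟩
    · rintro ⟨f, hf⟩
      exact ⟨fun i => f (Finsupp.single (Sum.inl (σ i)) 1),
        fun j => f (Finsupp.single (Sum.inr (τ j)) 1), hf⟩

/-- Each edge outside `C` is labelled by the two members of the two-basis that contain it. -/
theorem IsTwoBasis.exists_pair {m n l : ℕ} {C : Finset (Fin (m + 1) × Fin (n + 1))}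
    {S : Fin (l + 1) → Finset (Fin (m + 1) × Fin (n + 1))} (hS : IsTwoBasis C S) :
    ∃ p q : Fin (m + 1) × Fin (n + 1) → Fin (l + 1), ∀ e ∉ C, p e ≠ q e ∧
      Finset.univ.filter (fun w => e ∈ S w) = {p e, q e} := by
  have h : ∀ e, ∃ p q : Fin (l + 1), e ∉ C → p ≠ q ∧
      Finset.univ.filter (fun w => e ∈ S w) = {p, q} := by
    intro e
    by_cases he : e ∈ C
    · exact ⟨0, 0, fun h => absurd he h⟩
    · obtain ⟨p, q, hpq⟩ := Finset.card_eq_two.1 (hS.card_eq_two e he)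
      exact ⟨p, q, fun _ => hpq⟩
  choose p q hpq using h
  exact ⟨p, q, hpq⟩

theorem memberVec_eq_of_pair {ι : Type*} [DecidableEq ι] {l : ℕ} {S : Fin l → Finset ι} {e : ι}
    {p q : Fin l} (hpq : p ≠ q) (h : Finset.univ.filter (fun w => e ∈ S w) = {p, q}) :
    memberVec S e = Finsupp.single p 1 + Finsupp.single q 1 := by
  rw [memberVec, h, Finset.sum_pair hpq]

/-- A two-basis of `K_{m+1,n+1}` outside `C` makes `M*(K_{m+1,n+1}) \ C` graphic: the members of
the two-basis are the vertices of the graph. -/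
theorem IsTwoBasis.isGraphic_delete {m n l : ℕ} {C : Finset (Fin (m + 1) × Fin (n + 1))}
    {S : Fin (l + 1) → Finset (Fin (m + 1) × Fin (n + 1))} (hS : IsTwoBasis C S)
    (σ : Equiv.Perm (Fin (m + 1))) (τ : Equiv.Perm (Fin (n + 1))) :
    ((Graph.completeBipartite (m + 1) (n + 1)).cycleMatroid✶ ＼
      (bipartiteEdge σ τ '' (C : Set (Fin (m + 1) × Fin (n + 1))))).IsGraphic := by
  obtain ⟨p, q, hpq⟩ := hS.exists_pair
  refine Matroid.isGraphic_of_pairs (D := (C : Set (Fin (m + 1) × Fin (n + 1)))ᶜ)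
    (bipartiteEdge_injective σ τ) ?_ (fun e he => (hpq e he).1) fun I hI => ?_
  · rw [Matroid.delete_ground, Matroid.dual_ground, Graph.cycleMatroid_E,
      edgeSet_completeBipartite σ τ, ← Set.image_univ,
      ← Set.image_sdiff (bipartiteEdge_injective σ τ), Set.compl_eq_univ_sdiff]
  · have h := hS.dual_indep_iff σ τ (F := ∅) (linearIndepOn_empty _ _) (Set.disjoint_empty I)
    rw [Set.image_empty, Graph.deleteEdges_empty, Set.union_empty] at h
    rw [Matroid.delete_indep_iff, and_iff_left, h]
    · exact linearIndepOn_congr fun e he => memberVec_eq_of_pair (hpq e (hI he)).1 (hpq e (hI he)).2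
    · exact (Set.disjoint_image_iff (bipartiteEdge_injective σ τ)).2
        (Set.subset_compl_iff_disjoint_right.1 hI)

/-- The variant of `IsTwoBasis.isGraphic_delete` for a complete bipartite graph with an edge
removed. In the graph on the members of the two-basis this edge is contracted, which creates no
loop because no other edge lies in the same two members. -/
theorem IsTwoBasis.isGraphic_deleteEdges_delete {m n l : ℕ}
    {C : Finset (Fin (m + 1) × Fin (n + 1))}
    {S : Fin (l + 1) → Finset (Fin (m + 1) × Fin (n + 1))} (hS : IsTwoBasis C S)
    (σ : Equiv.Perm (Fin (m + 1))) (τ : Equiv.Perm (Fin (n + 1)))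
    {e : Fin (m + 1) × Fin (n + 1)} (he : e ∉ C)
    (hne : ∀ e' ∉ C, (∀ w, e' ∈ S w ↔ e ∈ S w) → e' = e) :
    (((Graph.completeBipartite (m + 1) (n + 1)).deleteEdges {bipartiteEdge σ τ e}).cycleMatroid✶ ＼
      (bipartiteEdge σ τ '' (C : Set (Fin (m + 1) × Fin (n + 1))))).IsGraphic := by
  obtain ⟨p, q, hpq⟩ := hS.exists_pair
  have hvec : ∀ e' ∉ C, memberVec S e' = Finsupp.single (p e') 1 + Finsupp.single (q e') 1 :=
    fun e' he' => memberVec_eq_of_pair (hpq e' he').1 (hpq e' he').2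
  have hsame : ∀ e' ∉ C, ({p e', q e'} : Finset (Fin (l + 1))) = {p e, q e} → e' = e := by
    intro e' he' h
    refine hne e' he' fun w => ?_
    rw [← (hpq e' he').2, ← (hpq e he).2] at h
    simpa using Finset.ext_iff.1 h w
  have hinj := bipartiteEdge_injective σ τ
  let π : Fin (l + 1) → Fin (l + 1) := fun w => if w = q e then p e else w
  refine Matroid.isGraphic_of_pairs (p := π ∘ p) (q := π ∘ q)
    (D := {e' | e' ≠ e ∧ e' ∉ C}) hinj ?_ (fun e' he' h => ?_) fun I hI => ?_
  · rw [Matroid.delete_ground, Matroid.dual_ground, Graph.cycleMatroid_E,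
      Graph.edgeSet_deleteEdges, edgeSet_completeBipartite σ τ, ← Set.image_univ,
      ← Set.image_singleton, ← Set.image_sdiff hinj, ← Set.image_sdiff hinj]
    congr 1
    ext e'
    simp
  · have h1 := (hpq e' he'.2).1
    have h2 : ({p e', q e'} : Finset (Fin (l + 1))) ≠ {p e, q e} :=
      fun h => he'.1 (hsame e' he'.2 h)
    simp only [Function.comp_apply, π] at h
    split_ifs at h with h3 h4 h4
    · exact h1 (h3.trans h4.symm)
    · exact h2 (by rw [h3, ← h, Finset.pair_comm])
    · exact h2 (by rw [h, h4])
    · exact h1 h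
  · have heI : e ∉ I := fun h => (hI h).1 rfl
    have h0 : memberVec S e ≠ 0 := fun h0 => by
      have := DFunLike.congr_fun ((hvec e he).symm.trans h0) (p e)
      simp [(hpq e he).1] at this
    have h := hS.dual_indep_iff σ τ (F := {e}) (I := I) (by simpa using h0) (by simpa using heI)
    rw [Set.image_singleton, Set.union_singleton,
      ← linearIndepOn_mapDomain_iff (hpq e he).1 (hvec e he) heI] at h
    rw [Matroid.delete_indep_iff, and_iff_left, h]
    · refine linearIndepOn_congr fun e' he' => ?_
      simp only [hvec e' (hI he').2, Finsupp.mapDomain_add, Finsupp.mapDomain_single,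
        Function.comp_apply, π]
    · exact (Set.disjoint_image_iff hinj).2 (Set.disjoint_left.2 fun e' he' => (hI he').2)

/-! ### Two-bases from the faces of the contracted graphs -/

/-- Contracting a four-cycle of `K_{3,5}` leaves two vertices joined by a pair of parallel edges and
by three paths of length two, one edge of each doubled. The sets are its eight faces (four digons
and four faces between consecutive connections), completed to even subgraphs by edges of the
cycle. -/
theorem isTwoBasis_three_five_two : IsTwoBasis (bipartiteCycle 3 5 2) ![
    {(0, 0), (0, 2), (1, 0), (1, 2)},
    {(0, 0), (0, 3), (1, 0), (1, 3)},
    {(0, 0), (0, 4), (1, 0), (1, 4)},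
    {(1, 0), (1, 1), (2, 0), (2, 1)},
    {(0, 0), (0, 3), (1, 0), (1, 2), (2, 2), (2, 3)},
    {(0, 0), (0, 4), (1, 0), (1, 3), (2, 3), (2, 4)},
    {(1, 0), (1, 4), (2, 0), (2, 4)},
    {(0, 1), (0, 2), (2, 1), (2, 2)}] where
  even_left := by decide +kernel
  even_right := by decide +kernel
  generates := ⟨![
    ![∅, ∅, ∅, ∅, ∅],
    ![∅, {0, 1, 2, 3, 4, 5, 6, 7}, {0}, {1}, {2}],
    ![∅, {0, 1, 2, 4, 5, 6, 7}, {0, 1, 2, 4, 5, 6}, {1, 2, 5, 6}, {2, 6}]], by decide +kernel⟩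
  card_eq_two := by decide +kernel

/-- Contracting a six-cycle of `K_{3,5}` leaves two bundles of three parallel edges at a common
vertex, together with three loops there, one for each chord of the cycle. The last three sets are
the faces inside the loops, the others the remaining faces, all completed by edges of the cycle. -/
theorem isTwoBasis_three_five_three : IsTwoBasis (bipartiteCycle 3 5 3) ![
    {(0, 0), (0, 1), (0, 2), (0, 3), (1, 0), (1, 3), (2, 1), (2, 2)},
    {(1, 2), (1, 3), (2, 2), (2, 3)},
    {(0, 0), (0, 4), (1, 1), (1, 4), (2, 0), (2, 1)},
    {(1, 1), (1, 4), (2, 1), (2, 4)},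
    {(0, 3), (0, 4), (2, 3), (2, 4)},
    {(0, 0), (0, 1), (1, 0), (1, 1)},
    {(1, 1), (1, 2), (2, 1), (2, 2)},
    {(1, 0), (1, 1), (2, 0), (2, 1)}] where
  even_left := by decide +kernel
  even_right := by decide +kernel
  generates := ⟨![
    ![∅, ∅, ∅, ∅, ∅],
    ![∅, {5}, {0, 1, 2, 3, 4, 5, 7}, {1, 2, 3, 4, 6, 7}, {2, 7}],
    ![∅, {5, 7}, {0, 1, 2, 3, 4, 5, 6}, {2, 3, 4}, {2, 3}]], by decide +kernel⟩
  card_eq_two := by decide +kernel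

/-- Contracting a four-cycle of `K_{4,4}` leaves a wheel with four doubled spokes. The sets are its
nine faces: four digons, the outer rim and four triangles, completed by edges of the cycle. -/
theorem exists_isTwoBasis_four_four_two :
    ∃ S : Fin 9 → Finset (Fin 4 × Fin 4), IsTwoBasis (bipartiteCycle 4 4 2) S ∧
      ∀ e ∉ bipartiteCycle 4 4 2, ∀ e' ∉ bipartiteCycle 4 4 2,
        (∀ w, e' ∈ S w ↔ e ∈ S w) → e' = e := by
  refine ⟨![
    {(0, 1), (0, 2), (1, 1), (1, 2)},
    {(0, 0), (0, 3), (1, 0), (1, 3)},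
    {(1, 0), (1, 1), (2, 0), (2, 1)},
    {(1, 0), (1, 1), (3, 0), (3, 1)},
    {(2, 2), (2, 3), (3, 2), (3, 3)},
    {(0, 1), (0, 2), (2, 1), (2, 2)},
    {(1, 0), (1, 2), (3, 0), (3, 2)},
    {(0, 1), (0, 3), (3, 1), (3, 3)},
    {(1, 0), (1, 3), (2, 0), (2, 3)}],
    ⟨by decide +kernel, by decide +kernel, ⟨![
      ![∅, ∅, ∅, ∅],
      ![∅, {0, 1, 2, 3, 4, 5, 6, 7, 8}, {1, 2, 3, 4, 5, 6, 7, 8}, {1}],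
      ![∅, {0, 1, 3, 4, 5, 6, 7, 8}, {0, 1, 3, 4, 6, 7, 8}, {1, 8}],
      ![∅, {0, 1, 2, 4, 5, 6, 7, 8}, {1, 2, 3, 4, 5, 7, 8}, {0, 1, 2, 4, 5, 6, 8}]],
      by decide +kernel⟩, by decide +kernel⟩, by decide +kernel⟩

/-- Contracting a six-cycle of `K_{4,4}` leaves a triangle with two tripled sides, and three loops at
the vertex where these sides meet. The last three sets are the faces inside the loops, the others
the remaining faces, all completed by edges of the cycle. -/
theorem exists_isTwoBasis_four_four_three :
    ∃ S : Fin 9 → Finset (Fin 4 × Fin 4), IsTwoBasis (bipartiteCycle 4 4 3) S ∧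
      ∀ e ∉ bipartiteCycle 4 4 3, ∀ e' ∉ bipartiteCycle 4 4 3,
        (∀ w, e' ∈ S w ↔ e ∈ S w) → e' = e := by
  refine ⟨![
    {(0, 0), (0, 1), (0, 2), (0, 3), (1, 0), (1, 3), (2, 1), (2, 2)},
    {(1, 2), (1, 3), (2, 2), (2, 3)},
    {(2, 0), (2, 1), (3, 0), (3, 1)},
    {(2, 1), (2, 2), (3, 1), (3, 2)},
    {(0, 0), (0, 3), (3, 0), (3, 3)},
    {(2, 2), (2, 3), (3, 2), (3, 3)},
    {(0, 0), (0, 1), (1, 0), (1, 1)},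
    {(1, 1), (1, 2), (2, 1), (2, 2)},
    {(1, 0), (1, 1), (2, 0), (2, 1)}],
    ⟨by decide +kernel, by decide +kernel, ⟨![
      ![∅, ∅, ∅, ∅],
      ![∅, {6}, {0, 1, 2, 3, 4, 5, 6, 8}, {1, 2, 3, 4, 5, 7, 8}],
      ![∅, {6, 8}, {0, 1, 2, 3, 4, 5, 6, 7}, {2, 3, 4, 5}],
      ![∅, {2, 6, 8}, {0, 1, 4, 5, 6, 7}, {4}]],
      by decide +kernel⟩, by decide +kernel⟩, by decide +kernel⟩

/-- Contracting an eight-cycle of `K_{4,4}` leaves eight loops, one for each chord. The sets are the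
common outer face of the loops and their eight insides, completed by edges of the cycle. -/
theorem exists_isTwoBasis_four_four_four :
    ∃ S : Fin 9 → Finset (Fin 4 × Fin 4), IsTwoBasis (bipartiteCycle 4 4 4) S ∧
      ∀ e ∉ bipartiteCycle 4 4 4, ∀ e' ∉ bipartiteCycle 4 4 4,
        (∀ w, e' ∈ S w ↔ e ∈ S w) → e' = e := by
  refine ⟨![
    {(0, 1), (0, 2), (1, 2), (1, 3), (2, 0), (2, 3), (3, 0), (3, 1)},
    {(0, 0), (0, 1), (1, 0), (1, 1)},
    {(0, 2), (0, 3), (3, 2), (3, 3)},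
    {(1, 1), (1, 2), (2, 1), (2, 2)},
    {(0, 0), (0, 3), (1, 0), (1, 3)},
    {(1, 0), (1, 1), (2, 0), (2, 1)},
    {(2, 2), (2, 3), (3, 2), (3, 3)},
    {(0, 0), (0, 3), (3, 0), (3, 3)},
    {(2, 1), (2, 2), (3, 1), (3, 2)}],
    ⟨by decide +kernel, by decide +kernel, ⟨![
      ![∅, ∅, ∅, ∅],
      ![∅, {1}, {0, 1, 4, 5, 6, 7, 8}, {4}],
      ![∅, {1, 5}, {0, 1, 3, 4, 6, 7, 8}, {0, 1, 2, 3, 4, 7, 8}],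
      ![∅, {0, 2, 3, 4, 5, 6}, {2, 7}, {7}]],
      by decide +kernel⟩, by decide +kernel⟩, by decide +kernel⟩

/-! ### Cocircuits of the two dual matroids -/

theorem isGraphic_delete_isCocircuit_three_five {K : Set (Sym2 (Fin 3 ⊕ Fin 5))}
    (hK : (Graph.completeBipartite 3 5).cycleMatroid✶.IsCocircuit K) :
    ((Graph.completeBipartite 3 5).cycleMatroid✶ ＼ K).IsGraphic := by
  rw [Matroid.isCocircuit_def, Matroid.dual_dual, Graph.cycleMatroid_isCircuit] at hK
  obtain ⟨t, ht2, htm, -, σ, τ, rfl⟩ := hK.exists_bipartiteCycle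
  interval_cases t
  · exact isTwoBasis_three_five_two.isGraphic_delete σ τ
  · exact isTwoBasis_three_five_three.isGraphic_delete σ τ

theorem isGraphic_delete_isCocircuit_four_four {e : Sym2 (Fin 4 ⊕ Fin 4)}
    (he : e ∈ (Graph.completeBipartite 4 4).edgeSet) {K : Set (Sym2 (Fin 4 ⊕ Fin 4))}
    (hK : ((Graph.completeBipartite 4 4).deleteEdges {e}).cycleMatroid✶.IsCocircuit K) :
    (((Graph.completeBipartite 4 4).deleteEdges {e}).cycleMatroid✶ ＼ K).IsGraphic := by
  rw [Matroid.isCocircuit_def, Matroid.dual_dual, Graph.cycleMatroid_isCircuit] at hK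
  obtain ⟨k, v, f, hv, hf, hl, rfl⟩ := hK
  have hcirc : (Graph.completeBipartite 4 4).IsCircle (Set.range f) :=
    ⟨k, v, f, hv, hf, fun i => ((Graph.deleteEdges_isLink ..).mp (hl i)).1, rfl⟩
  have heK : e ∉ Set.range f := by
    rintro ⟨i, hi⟩
    exact ((Graph.deleteEdges_isLink ..).mp (hl i)).2 hi
  obtain ⟨t, ht2, htm, -, σ, τ, hK⟩ := hcirc.exists_bipartiteCycle
  rw [edgeSet_completeBipartite σ τ] at he
  obtain ⟨e, rfl⟩ := he
  rw [hK] at heK ⊢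
  have heC : e ∉ bipartiteCycle 4 4 t := fun h => heK ⟨e, h, rfl⟩
  obtain ⟨S, hS, hne⟩ : ∃ S : Fin 9 → Finset (Fin 4 × Fin 4),
      IsTwoBasis (bipartiteCycle 4 4 t) S ∧ ∀ e ∉ bipartiteCycle 4 4 t,
        ∀ e' ∉ bipartiteCycle 4 4 t, (∀ w, e' ∈ S w ↔ e ∈ S w) → e' = e := by
    interval_cases t
    exacts [exists_isTwoBasis_four_four_two, exists_isTwoBasis_four_four_three,
      exists_isTwoBasis_four_four_four]
  exact hS.isGraphic_deleteEdges_delete σ τ heC (hne e heC)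

open scoped Matroid in
theorem lemma1 {α : Type*} (M : Matroid α)
    (hM : M.IsIsomorphic (Graph.completeBipartite 3 5).cycleMatroid✶ ∨
      ∃ e ∈ (Graph.completeBipartite 4 4).edgeSet,
        M.IsIsomorphic ((Graph.completeBipartite 4 4).deleteEdges {e}).cycleMatroid✶) :
    (∀ Y : Set α, M.IsCocircuit Y → (M ＼ Y).IsGraphic) ∧
      (∀ Y : Set α, M✶.IsCircuit Y → (M✶ ／ Y).IsCographic) := by
  have key : ∀ Y : Set α, M.IsCocircuit Y → (M ＼ Y).IsGraphic := by
    rcases hM with hM | ⟨e, he, hM⟩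
    · exact fun Y => hM.isGraphic_delete_isCocircuit
        fun K => isGraphic_delete_isCocircuit_three_five
    · exact fun Y => hM.isGraphic_delete_isCocircuit
        fun K => isGraphic_delete_isCocircuit_four_four he
  refine ⟨key, fun Y hY => ?_⟩
  rw [Matroid.IsCographic, Matroid.dual_contract_dual]
  exact key Y hY
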